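/- Let $\alpha\in(0,1)$ and let $L:(0,\infty)\to(0,\infty)$ be a slowly varying function, i.e. $L$ is measurable and $\lim_{x\to\infty}L(cx)/L(x)=1$ for every $c>0$. Let $K(n)=L(n)/n^{1+\alpha}$ for $n\ge 1$ and assume that $\sum_{n\ge1}K(n)=1$ (the recurrent case). Let $l_1,l_2,\dots$ be i.i.d. integer valued random variables with $\mathbf P(l_1=n)=K(n)$ for $n\ge1$, let $\tau_k=\sum_{i=1}^k l_i$ for $k\ge0$ (so $\tau_0=0$) and $\tau=\{\tau_0,\tau_1,\dots\}$. Let $(a_n)_{n\ge0}$ be a sequence with $a_n\to\infty$ and $$\frac{n\,\Gamma(1-\alpha)\,L(a_n)}{\alpha\,a_n^{\alpha}}\longrightarrow 1\qquad(n\to\infty),$$ and let $(b_n)_{n\ge0}$ be an asymptotic inverse of $(a_n)$, i.e. $a_{[b_n]}\sim n$ and $b_{[a_n]}\sim n$ as $n\to\infty$, where $[\cdot]$ is the integer part and $x_n\sim y_n$ means $x_n/y_n\to1$. Let $(\sigma^{(\alpha)}_s)_{s\ge0}$ be the $\alpha$-stable subordinator, that is the non-decreasing Lévy process with $\mathbf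 E[e^{-\lambda\sigma^{(\alpha)}_s}]=e^{-s\lambda^\alpha}$ for all $\lambda>0$, $s\ge0$, and let $L^{(\alpha)}_t=\inf\{s\ge0:\sigma^{(\alpha)}_s\ge t\}$ be its local time. Then, as $N\to\infty$, the number of renewal epochs in $[0,N]$ divided by $b_N$ converges in law to $L^{(\alpha)}_1$: $$\frac{|\tau\cap[0,N]|}{b_N}\Longrightarrow L^{(\alpha)}_1 .$$ -/

import Mathlib

open MeasureTheory ProbabilityTheory Filter Set
open scoped Topology NNReal

noncomputable section

/-- `L` is a slowly varying function on `(0, ∞)`: it is positive and measurable there and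
`L (c x) / L x → 1` as `x → ∞`, for every `c > 0`. Values outside `(0, ∞)` play no role. -/
structure IsSlowlyVarying (L : ℝ → ℝ) : Prop where
  measurable : Measurable (fun x : Ioi (0 : ℝ) => L x)
  pos : ∀ x, 0 < x → 0 < L x
  tendsto : ∀ c, 0 < c → Tendsto (fun x => L (c * x) / L x) atTop (𝓝 1)

/-- The inter-arrival weights `K n = L n / n ^ (1 + α)`, used for `n ≥ 1`. -/
def interarrivalWeight (α : ℝ) (L : ℝ → ℝ) (n : ℕ) : ℝ :=
  L n / (n : ℝ) ^ (1 + α)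

/-- The integer valued random variables `l 0, l 1, …` are i.i.d. with
`P (l i = n) = K n` for all `n ≥ 1`. -/
structure IsInterarrivalSequence {Ω : Type*} [MeasurableSpace Ω] (K : ℕ → ℝ)
    (l : ℕ → Ω → ℕ) (μ : Measure Ω) : Prop where
  measurable : ∀ i, Measurable (l i)
  indep : iIndepFun l μ
  law : ∀ i n, 1 ≤ n → μ.real {ω | l i ω = n} = K n

/-- The renewal set `τ = {τ_0, τ_1, …}`, where `τ_k` is the sum of the first `k` inter-arrival
times (so `τ_0 = 0`). -/
def renewalSet {Ω : Type*} (l : ℕ → Ω → ℕ) (ω : Ω) : Set ℕ :=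
  range fun k => ∑ i ∈ Finset.range k, l i ω

/-- The number of renewal epochs in `[0, N]`, i.e. the cardinality of `τ ∩ [0, N]`. -/
def renewalCount {Ω : Type*} (l : ℕ → Ω → ℕ) (N : ℕ) (ω : Ω) : ℕ :=
  (renewalSet l ω ∩ Iic N).ncard

/-- The normalizing sequences of the stable limit theorem: `a n → ∞` and
`n Γ(1 - α) L(a n) / (α (a n) ^ α) → 1`. -/
structure IsStableNormalizing (α : ℝ) (L : ℝ → ℝ) (a : ℕ → ℝ) : Prop where
  tendsto_atTop : Tendsto a atTop atTop
  tendsto_one : Tendsto (fun n : ℕ => n * Real.Gamma (1 - α) * L (a n) / (α * (a n) ^ α))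
    atTop (𝓝 1)

/-- `b` is an asymptotic inverse of `a`: `a_[b_n] ∼ n` and `b_[a_n] ∼ n` as `n → ∞`, where `[·]`
is the integer part. -/
structure IsAsymptoticInverse (a b : ℕ → ℝ) : Prop where
  left : Asymptotics.IsEquivalent atTop (fun n => a ⌊b n⌋₊) (fun n : ℕ => (n : ℝ))
  right : Asymptotics.IsEquivalent atTop (fun n => b ⌊a n⌋₊) (fun n : ℕ => (n : ℝ))

/-- A real valued Lévy process: it starts from zero, has independent and stationary increments,
and almost surely its paths are right-continuous with left limits. -/
structure IsLevyProcess {Ω : Type*} [MeasurableSpace Ω] (σ : ℝ≥0 → Ω → ℝ)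
    (P : Measure Ω) : Prop where
  measurable : ∀ t, Measurable (σ t)
  zero : ∀ᵐ ω ∂P, σ 0 ω = 0
  indep_increments : HasIndepIncrements σ P
  stationary_increments : ∀ s h, IdentDistrib (fun ω => σ (s + h) ω - σ s ω) (σ h) P P
  right_continuous : ∀ᵐ ω ∂P, ∀ t, ContinuousWithinAt (fun s => σ s ω) (Ici t) t
  left_limits : ∀ᵐ ω ∂P, ∀ t, ∃ x, Tendsto (fun s => σ s ω) (𝓝[<] t) (𝓝 x)

/-- A subordinator: a Lévy process with almost surely non-decreasing paths. -/
structure IsSubordinator {Ω : Type*} [MeasurableSpace Ω] (σ : ℝ≥0 → Ω → ℝ)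
    (P : Measure Ω) : Prop extends IsLevyProcess σ P where
  monotone : ∀ᵐ ω ∂P, Monotone fun t => σ t ω

/-- The `α`-stable subordinator: `E [exp (-r σ_t)] = exp (-t r ^ α)` for `r > 0` and `t ≥ 0`. -/
structure IsStableSubordinator {Ω : Type*} [MeasurableSpace Ω] (α : ℝ) (σ : ℝ≥0 → Ω → ℝ)
    (P : Measure Ω) : Prop extends IsSubordinator σ P where
  laplace : ∀ (r : ℝ) (t : ℝ≥0), 0 < r →
    ∫ ω, Real.exp (-r * σ t ω) ∂P = Real.exp (-(t : ℝ) * r ^ α)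

/-- The local time `L_t = inf {s ≥ 0 | σ_s ≥ t}`, the generalized inverse of `σ`. -/
def localTime {Ω : Type*} (σ : ℝ≥0 → Ω → ℝ) (t : ℝ) (ω : Ω) : ℝ :=
  ((sInf {s : ℝ≥0 | t ≤ σ s ω} : ℝ≥0) : ℝ)

end

/-! Counting renewals is inverse to summing gaps: with `τ_k` the `k`-th epoch, at most `k` epochs
lie in `[0, N]` exactly when `τ_k > N`, just as `L_1 ≤ x` exactly when `σ_x ≥ 1`. Hence `P(|τ ∩ [0,
N]| / b_N ≤ x) = P(τ_k / N > 1)` with `k = ⌊x b_N⌋`, and it suffices that `τ_k / N` converges in law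
to `σ_x`, provided 1 is not an atom of `σ_x`. That excludes only countably many `x`, which is
harmless for convergence in law.

The Laplace transform of `τ_k / N` at `r` is `(1 - p_N) ^ k` with `p_N = ∑ K(n) (1 - e^{-rn/N})`.
After multiplication by `N^α / L(N)`, `p_N` is a Riemann sum for `∫ v^{-1-α} (1 - e^{-rv}) dv = r^α
Γ(1-α) / α`; Potter bounds dominate it (`IsSlowlyVarying.tendsto_rpow_div_mul_tsum`). Since `b_N
L(N) / N^α → α / Γ(1-α)` (`IsAsymptoticInverse.tendsto_mul_div_rpow`), `k p_N → x r^α`, and the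
transform tends to `e^{-x r^α}`, that of `σ_x`.

Laplace transforms at positive integers are moments of `e^{-X} ∈ [0, 1]`, so Weierstrass
approximation turns their convergence into convergence in law
(`tendsto_measureReal_le_of_tendsto_mgf`). -/

/-! ### Slowly varying functions -/

/-- **Uniform convergence theorem** for slowly varying functions, in additive form. -/
theorem exists_forall_abs_sub_le_of_tendsto {h : ℝ → ℝ} (hm : Measurable h)
    (hh : ∀ u, Tendsto (fun x => h (x + u) - h x) atTop (𝓝 0)) {ε : ℝ} (hε : 0 < ε) :
    ∃ X, ∀ x ≥ X, ∀ u ∈ Icc (0 : ℝ) 1, |h (x + u) - h x| ≤ ε := by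
  by_contra! hcon
  choose x hx u hu hxu using fun n : ℕ => hcon n
  have key : ∀ y : ℕ → ℝ, (∀ n : ℕ, (n : ℝ) ≤ y n) → ∀ᶠ n in atTop,
      volume ({v | ε / 2 ≤ |h (y n + v) - h (y n)|} ∩ Icc 0 2) < ENNReal.ofReal (1 / 2) := by
    intro y hy
    have hyt : Tendsto y atTop atTop := tendsto_atTop_mono hy tendsto_natCast_atTop_atTop
    have h1 : TendstoInMeasure (volume.restrict (Icc (0 : ℝ) 2))
        (fun n v => h (y n + v) - h (y n)) atTop (fun _ => 0) := by
      refine tendstoInMeasure_of_tendsto_ae (fun n => ?_) (ae_of_all _ fun v => ?_)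
      · exact ((hm.comp (measurable_const.add measurable_id)).sub_const _).aestronglyMeasurable
      · exact (hh v).comp hyt
    have h2 := tendstoInMeasure_iff_norm.1 h1 (ε / 2) (by positivity)
    have h3 := h2.eventually_lt_const (u := ENNReal.ofReal (1 / 2)) (by simp)
    filter_upwards [h3] with n hn
    rwa [Measure.restrict_apply' measurableSet_Icc, show
      {v : ℝ | ε / 2 ≤ ‖h (y n + v) - h (y n) - 0‖} = {v | ε / 2 ≤ |h (y n + v) - h (y n)|} by
        simp [Real.norm_eq_abs]] at hn
  obtain ⟨n, hn1, hn2⟩ := ((key x hx).and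
    (key (fun n => x n + u n) fun n => by linarith [hx n, (hu n).1])).exists
  set A := {v | ε / 2 ≤ |h (x n + v) - h (x n)|} ∩ Icc (0 : ℝ) 2
  set B := {v | ε / 2 ≤ |h (x n + u n + v) - h (x n + u n)|} ∩ Icc (0 : ℝ) 2
  -- The bad shifts seen from `x n` and from `x n + u n` would have to cover `[1, 2]`: a shift good
  -- for both compares the two base values through the common point `x n + v`. Each bad set has
  -- measure below `1 / 2`.
  have hsub : Icc (1 : ℝ) 2 ⊆ A ∪ (fun v => v + -u n) ⁻¹' B := by
    intro v hv
    by_contra hvn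
    simp only [mem_union, not_or, A, B, mem_preimage, mem_inter_iff, mem_ofPred_eq, not_and,
      mem_Icc] at hvn
    have e1 : |h (x n + v) - h (x n)| < ε / 2 := by
      by_contra hc
      exact hvn.1 (not_lt.1 hc) (by linarith [hv.1]) hv.2
    have e2 : |h (x n + u n + (v + -u n)) - h (x n + u n)| < ε / 2 := by
      by_contra hc
      exact hvn.2 (not_lt.1 hc) (by linarith [hv.1, (hu n).2]) (by linarith [hv.2, (hu n).1])
    rw [show x n + u n + (v + -u n) = x n + v by ring] at e2
    have := hxu n
    rw [abs_lt] at e1 e2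
    rcases lt_abs.1 this with h' | h' <;> linarith
  have hvol := (measure_mono hsub).trans (measure_union_le (μ := volume) _ _)
  rw [measure_preimage_add_right, Real.volume_Icc] at hvol
  have := hvol.trans_lt (ENNReal.add_lt_add hn1 hn2)
  rw [← ENNReal.ofReal_add (by norm_num) (by norm_num)] at this
  norm_num at this

/-- **Potter bound**, in additive form. -/
theorem exists_forall_abs_sub_le_mul_abs_sub_add_one {h : ℝ → ℝ} (hm : Measurable h)
    (hh : ∀ u, Tendsto (fun x => h (x + u) - h x) atTop (𝓝 0)) {ε : ℝ} (hε : 0 < ε) :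
    ∃ X, ∀ x ≥ X, ∀ y ≥ X, |h y - h x| ≤ ε * (|y - x| + 1) := by
  obtain ⟨X, hX⟩ := exists_forall_abs_sub_le_of_tendsto hm hh hε
  -- Chain the uniform bound over `n` steps of length at most one.
  have key : ∀ (n : ℕ), ∀ x ≥ X, ∀ y, x ≤ y → y ≤ x + n → |h y - h x| ≤ ε * n := by
    intro n
    induction n with
    | zero =>
      intro x _ y h1 h2
      obtain rfl : y = x := le_antisymm (by simpa using h2) h1
      simp
    | succ n ih =>
      intro x hx y h1 h2
      push_cast at h2 ⊢
      rcases le_total y (x + 1) with h3 | h3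
      · have := hX x hx (y - x) ⟨by linarith, by linarith⟩
        rw [add_sub_cancel] at this
        nlinarith [mul_nonneg hε.le (Nat.cast_nonneg (α := ℝ) n)]
      · have e1 := ih (x + 1) (by linarith) y h3 (by linarith)
        have e2 := hX x hx 1 ⟨by norm_num, le_rfl⟩
        have := abs_sub_le (h y) (h (x + 1)) (h x)
        linarith
  have key2 : ∀ x ≥ X, ∀ y, x ≤ y → |h y - h x| ≤ ε * (|y - x| + 1) := by
    intro x hx y hxy
    refine (key ⌈y - x⌉₊ x hx y hxy (by linarith [Nat.le_ceil (y - x)])).trans ?_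
    gcongr
    rw [abs_of_nonneg (sub_nonneg.2 hxy)]
    exact (Nat.ceil_lt_add_one (sub_nonneg.2 hxy)).le
  refine ⟨X, fun x hx y hy => ?_⟩
  rcases le_total x y with hxy | hxy
  · exact key2 x hx y hxy
  · rw [abs_sub_comm (h y), abs_sub_comm y]
    exact key2 y hy x hxy

namespace IsSlowlyVarying

variable {L : ℝ → ℝ}

theorem exists_forall_abs_log_sub_le (hL : IsSlowlyVarying L) {ε : ℝ} (hε : 0 < ε) :
    ∃ X > 0, ∀ x ≥ X, ∀ y ≥ X,
      |Real.log (L y) - Real.log (L x)| ≤ ε * (|Real.log y - Real.log x| + 1) := by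
  have hm : Measurable fun x => Real.log (L (Real.exp x)) := by
    have : Measurable fun x : ℝ => (⟨Real.exp x, Real.exp_pos x⟩ : Ioi (0 : ℝ)) :=
      Real.measurable_exp.subtype_mk
    exact Real.measurable_log.comp (hL.measurable.comp this)
  have hh : ∀ u, Tendsto (fun x => Real.log (L (Real.exp (x + u))) - Real.log (L (Real.exp x)))
      atTop (𝓝 0) := by
    intro u
    have h1 := ((hL.tendsto (Real.exp u) (Real.exp_pos u)).comp Real.tendsto_exp_atTop).log
      one_ne_zero
    rw [Real.log_one] at h1
    refine h1.congr fun x => ?_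
    have p : ∀ y, L (Real.exp y) ≠ 0 := fun y => (hL.pos _ (Real.exp_pos y)).ne'
    simp only [Function.comp]
    rw [← Real.exp_add, Real.log_div (p _) (p _), add_comm u]
  obtain ⟨X, hX⟩ := exists_forall_abs_sub_le_mul_abs_sub_add_one hm hh hε
  refine ⟨Real.exp X, Real.exp_pos X, fun x hx y hy => ?_⟩
  have hx0 : 0 < x := (Real.exp_pos X).trans_le hx
  have hy0 : 0 < y := (Real.exp_pos X).trans_le hy
  have := hX (Real.log x) ((Real.le_log_iff_exp_le hx0).2 hx) (Real.log y)
    ((Real.le_log_iff_exp_le hy0).2 hy)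
  simpa only [Real.exp_log hx0, Real.exp_log hy0] using this

/-- Extends slow variation from a fixed factor `c` to a factor that only converges to `c`; it is
used for rounded arguments `⌈u N⌉` and for `a ⌊b N⌋ ∼ N`. -/
theorem tendsto_div_of_tendsto_div (hL : IsSlowlyVarying L) {ι : Type*} {l : Filter ι}
    {x y : ι → ℝ} {c : ℝ} (hc : 0 < c) (hx : Tendsto x l atTop) (hy : Tendsto y l atTop)
    (hxy : Tendsto (fun i => y i / x i) l (𝓝 c)) :
    Tendsto (fun i => L (y i) / L (x i)) l (𝓝 1) := by
  have hlog : Tendsto (fun i => Real.log (L (y i)) - Real.log (L (x i))) l (𝓝 0) := by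
    rw [Metric.tendsto_nhds]
    intro ε hε
    set M := |Real.log c| + 1
    have hM : 0 < M + 1 := by positivity
    obtain ⟨X, hX0, hX⟩ := hL.exists_forall_abs_log_sub_le (ε := ε / (2 * (M + 1))) (by positivity)
    have hb : ∀ᶠ i in l, |Real.log (y i / x i)| < M :=
      ((hxy.log hc.ne').abs).eventually_lt_const (by simp [M])
    filter_upwards [hx.eventually_ge_atTop X, hy.eventually_ge_atTop X, hb] with i h1 h2 h3
    rw [Real.log_div (by linarith) (by linarith)] at h3
    rw [Real.dist_eq, sub_zero]
    calc _ ≤ _ := hX _ h1 _ h2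
      _ ≤ ε / (2 * (M + 1)) * (M + 1) := by gcongr
      _ = ε / 2 := by field_simp
      _ < ε := by linarith
  have := (Real.continuous_exp.tendsto 0).comp hlog
  rw [Real.exp_zero] at this
  refine this.congr' ?_
  filter_upwards [hx.eventually_gt_atTop 0, hy.eventually_gt_atTop 0] with i h1 h2
  simp only [Function.comp]
  rw [Real.exp_sub, Real.exp_log (hL.pos _ h2), Real.exp_log (hL.pos _ h1)]

/-- **Potter bound** along the positive integers, with no restriction to large arguments. -/
theorem exists_forall_nat_div_le (hL : IsSlowlyVarying L) {δ : ℝ} (hδ : 0 < δ) :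
    ∃ C > 0, ∀ m n : ℕ, 1 ≤ m → 1 ≤ n →
      L m / L n ≤ C * (((m : ℝ) / n) ^ δ + ((m : ℝ) / n) ^ (-δ)) := by
  obtain ⟨X, hX0, hX⟩ := hL.exists_forall_abs_log_sub_le hδ
  set k := ⌈X⌉₊
  have hk : 1 ≤ k := Nat.one_le_iff_ne_zero.2 (Nat.ceil_pos.2 hX0).ne'
  have hkX : X ≤ k := Nat.le_ceil X
  -- Below `k` the asymptotic bound says nothing, so `m` is replaced by `max m k`; the finitely many
  -- corrections are absorbed in `M` and `log k`.
  set M := ∑ i ∈ Finset.range k, |Real.log (L i) - Real.log (L k)|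
  have hM : ∀ m : ℕ, |Real.log (L m) - Real.log (L (max m k : ℕ))| ≤ M := by
    intro m
    rcases le_or_gt k m with h | h
    · rw [max_eq_left h, sub_self, abs_zero]
      exact Finset.sum_nonneg fun _ _ => abs_nonneg _
    · rw [max_eq_right h.le]
      exact Finset.single_le_sum (f := fun i : ℕ => |Real.log (L i) - Real.log (L k)|)
        (fun _ _ => abs_nonneg _) (Finset.mem_range.2 h)
  have hmax : ∀ m : ℕ, 1 ≤ m → |Real.log m - Real.log (max m k : ℕ)| ≤ Real.log k := by
    intro m hm
    have hm' : (1 : ℝ) ≤ m := by exact_mod_cast hm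
    rcases le_or_gt k m with h | h
    · rw [max_eq_left h, sub_self, abs_zero]
      exact Real.log_natCast_nonneg k
    · rw [max_eq_right h.le, abs_sub_comm, abs_of_nonneg]
      · linarith [Real.log_nonneg hm']
      · rw [sub_nonneg]
        exact Real.log_le_log (by linarith) (by exact_mod_cast h.le)
  refine ⟨Real.exp (2 * M + δ * (2 * Real.log k + 1)), Real.exp_pos _, fun m n hm hn => ?_⟩
  have hm0 : (0 : ℝ) < m := by exact_mod_cast hm
  have hn0 : (0 : ℝ) < n := by exact_mod_cast hn
  have hmain : Real.log (L m) - Real.log (L n) ≤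
      δ * |Real.log ((m : ℝ) / n)| + (2 * M + δ * (2 * Real.log k + 1)) := by
    have hge : ∀ m : ℕ, X ≤ ((max m k : ℕ) : ℝ) := fun m =>
      hkX.trans (by exact_mod_cast le_max_right m k)
    have e1 := hX _ (hge n) _ (hge m)
    have e2 := hM m
    have e3 := hM n
    have e4 := hmax m hm
    have e5 := hmax n hn
    have e6 : |Real.log (max m k : ℕ) - Real.log (max n k : ℕ)| ≤
        |Real.log ((m : ℝ) / n)| + 2 * Real.log k := by
      rw [Real.log_div hm0.ne' hn0.ne']
      have t1 := abs_sub_le (Real.log (max m k : ℕ)) (Real.log m) (Real.log (max n k : ℕ))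
      have t2 := abs_sub_le (Real.log m) (Real.log n) (Real.log (max n k : ℕ))
      rw [abs_sub_comm (Real.log (max m k : ℕ)) (Real.log m)] at t1
      linarith
    have e7 := mul_le_mul_of_nonneg_left (add_le_add_left e6 1) hδ.le
    rw [abs_le] at e2 e3
    have e8 := (le_abs_self _).trans e1
    nlinarith
  have hv : 0 < (m : ℝ) / n := div_pos hm0 hn0
  have hexp : Real.exp (δ * |Real.log ((m : ℝ) / n)|) ≤
      ((m : ℝ) / n) ^ δ + ((m : ℝ) / n) ^ (-δ) := by
    rw [Real.rpow_def_of_pos hv, Real.rpow_def_of_pos hv]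
    rcases abs_cases (Real.log ((m : ℝ) / n)) with ⟨h, _⟩ | ⟨h, _⟩ <;> rw [h]
    · rw [mul_comm]
      linarith [Real.exp_pos (Real.log ((m : ℝ) / n) * -δ)]
    · rw [show δ * -Real.log ((m : ℝ) / n) = Real.log ((m : ℝ) / n) * -δ by ring]
      linarith [Real.exp_pos (Real.log ((m : ℝ) / n) * δ)]
  rw [← Real.exp_log (hL.pos _ hm0), ← Real.exp_log (hL.pos _ hn0), ← Real.exp_sub]
  refine (Real.exp_le_exp.2 hmain).trans ?_
  rw [Real.exp_add, mul_comm]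
  gcongr

end IsSlowlyVarying

/-! ### Riemann sums and the Lévy–Khintchine integral -/

theorem one_sub_exp_neg_nonneg {x : ℝ} (hx : 0 ≤ x) : 0 ≤ 1 - Real.exp (-x) := by
  have := Real.exp_le_one_iff.2 (neg_nonpos.2 hx)
  linarith

theorem one_sub_exp_neg_le (x : ℝ) : 1 - Real.exp (-x) ≤ x := by
  linarith [Real.add_one_le_exp (-x)]

theorem one_sub_exp_neg_le_one (x : ℝ) : 1 - Real.exp (-x) ≤ 1 := by
  linarith [Real.exp_pos (-x)]

/-- A sum over the positive integers as the integral of a step function. -/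
theorem hasSum_integral_comp_natCeil {f : ℕ → ℝ} {N : ℝ} (hN : 0 < N)
    (hf : IntegrableOn (fun u => f ⌈u * N⌉₊) (Ioi 0)) :
    HasSum (fun n => N⁻¹ * f (n + 1)) (∫ u : ℝ in Ioi 0, f ⌈u * N⌉₊) := by
  set s : ℕ → Set ℝ := fun n => Ioc (n / N) ((n + 1) / N)
  have hs : ∀ n u, u ∈ s n ↔ ⌈u * N⌉₊ = n + 1 := by
    intro n u
    rw [Nat.ceil_eq_iff (Nat.succ_ne_zero n)]
    simp only [s, mem_Ioc, div_lt_iff₀ hN, le_div_iff₀ hN]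
    simp
  have hU : ⋃ n, s n = Ioi 0 := by
    ext u
    simp only [mem_iUnion, hs, mem_Ioi]
    constructor
    · rintro ⟨n, hn⟩
      have : 0 < u * N := Nat.ceil_pos.1 (by omega)
      exact (pos_iff_pos_of_mul_pos this).2 hN
    · intro hu
      have : 0 < ⌈u * N⌉₊ := Nat.ceil_pos.2 (mul_pos hu hN)
      exact ⟨⌈u * N⌉₊ - 1, by omega⟩
  have key := hasSum_integral_iUnion (μ := volume) (s := s) (f := fun u => f ⌈u * N⌉₊)
    (fun n => measurableSet_Ioc) (fun i j hij => Set.disjoint_left.2 fun u hi hj => hij (by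
      have h1 := (hs i u).1 hi
      have h2 := (hs j u).1 hj
      omega)) (by rwa [hU])
  rw [hU] at key
  refine key.congr_fun fun n => ?_
  rw [setIntegral_congr_fun (g := fun _ => f (n + 1)) measurableSet_Ioc
    fun u hu => by simp only [(hs n u).1 hu]]
  rw [setIntegral_const, Real.volume_real_Ioc_of_le (by gcongr; linarith), smul_eq_mul]
  congr 1
  field_simp
  ring

/-- The density `v ^ (-1 - α) (1 - e ^ (-r v))` of the Lévy–Khintchine integral of the stable
subordinator. -/
noncomputable def stableDensity (α r v : ℝ) : ℝ := v ^ (-1 - α) * (1 - Real.exp (-(r * v)))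

/-- An integrable function dominating the renewal Riemann sums. -/
noncomputable def stableBound (α δ r u : ℝ) : ℝ :=
  2 * (1 + r) * if u ≤ 1 then u ^ (-α - δ) else u ^ (δ - 1 - α)

section Stable

variable {α δ r : ℝ}

theorem stableDensity_nonneg (hr : 0 ≤ r) {v : ℝ} (hv : 0 ≤ v) : 0 ≤ stableDensity α r v :=
  mul_nonneg (Real.rpow_nonneg hv _) (one_sub_exp_neg_nonneg (mul_nonneg hr hv))

theorem continuousAt_stableDensity {v : ℝ} (hv : 0 < v) : ContinuousAt (stableDensity α r) v := by
  unfold stableDensity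
  exact (Real.continuousAt_rpow_const v _ (Or.inl hv.ne')).mul (by fun_prop)

theorem measurable_stableDensity : Measurable (stableDensity α r) := by
  unfold stableDensity
  fun_prop

/-- The Riemann sums evaluate at `v = ⌈u N⌉ / N`, to the right of `u`, so the majorant at `u` must
control every `v ≥ u`. For `v ≤ 1` use `1 - e^{-x} ≤ x`, for `v > 1` use `1 - e^{-x} ≤ 1`; the
Potter loss `δ` is kept small enough for integrability at both ends. -/
theorem add_rpow_mul_stableDensity_le (hr : 0 ≤ r) (hδ : 0 < δ) (hδα : δ ≤ α)
    (hδα' : δ ≤ 1 - α) {u v : ℝ} (hu : 0 < u) (huv : u ≤ v) :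
    (v ^ δ + v ^ (-δ)) * stableDensity α r v ≤ stableBound α δ r u := by
  have hv := hu.trans_le huv
  unfold stableDensity stableBound
  rcases le_or_gt v 1 with h | h
  · rw [if_pos (huv.trans h)]
    have e1 : v ^ δ ≤ v ^ (-δ) := Real.rpow_le_rpow_of_exponent_ge hv h (by linarith)
    calc (v ^ δ + v ^ (-δ)) * (v ^ (-1 - α) * (1 - Real.exp (-(r * v))))
        ≤ (v ^ (-δ) + v ^ (-δ)) * (v ^ (-1 - α) * (r * v ^ (1 : ℝ))) := by
          rw [Real.rpow_one]
          gcongr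
          · exact mul_nonneg (Real.rpow_nonneg hv.le _) (one_sub_exp_neg_nonneg (by positivity))
          · exact one_sub_exp_neg_le _
      _ = 2 * r * v ^ (-α - δ) := by
          rw [show -α - δ = -δ + (-1 - α) + 1 by ring, Real.rpow_add hv, Real.rpow_add hv]
          ring
      _ ≤ 2 * (1 + r) * u ^ (-α - δ) := by
          have := Real.rpow_le_rpow_of_nonpos hu huv (z := -α - δ) (by linarith)
          have h0 := Real.rpow_nonneg hv.le (-α - δ)
          gcongr
          linarith
  · have e1 : v ^ (-δ) ≤ v ^ δ := Real.rpow_le_rpow_of_exponent_le h.le (by linarith)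
    calc (v ^ δ + v ^ (-δ)) * (v ^ (-1 - α) * (1 - Real.exp (-(r * v))))
        ≤ (v ^ δ + v ^ δ) * (v ^ (-1 - α) * 1) := by
          gcongr
          · exact mul_nonneg (Real.rpow_nonneg hv.le _) (one_sub_exp_neg_nonneg (by positivity))
          · exact one_sub_exp_neg_le_one _
      _ = 2 * v ^ (δ - 1 - α) := by
          rw [show δ - 1 - α = δ + (-1 - α) by ring, Real.rpow_add hv]
          ring
      _ ≤ 2 * (1 + r) * (if u ≤ 1 then u ^ (-α - δ) else u ^ (δ - 1 - α)) := by
          have h2 : v ^ (δ - 1 - α) ≤ if u ≤ 1 then u ^ (-α - δ) else u ^ (δ - 1 - α) := by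
            split_ifs with h3
            · exact (Real.rpow_le_one_of_one_le_of_nonpos h.le (by linarith)).trans
                (Real.one_le_rpow_of_pos_of_le_one_of_nonpos hu h3 (by linarith))
            · exact Real.rpow_le_rpow_of_nonpos hu huv (by linarith)
          have h0 := Real.rpow_nonneg hv.le (δ - 1 - α)
          gcongr
          linarith

theorem stableDensity_le (hr : 0 ≤ r) (hδ : 0 < δ) (hδα : δ ≤ α) (hδα' : δ ≤ 1 - α) {u : ℝ}
    (hu : 0 < u) : stableDensity α r u ≤ stableBound α δ r u := by
  refine le_trans ?_ (add_rpow_mul_stableDensity_le hr hδ hδα hδα' hu le_rfl)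
  refine le_mul_of_one_le_left (stableDensity_nonneg hr hu.le) ?_
  have h1 := Real.rpow_nonneg hu.le δ
  have h2 := Real.rpow_nonneg hu.le (-δ)
  rcases le_total u 1 with h | h
  · linarith [Real.one_le_rpow_of_pos_of_le_one_of_nonpos hu h (neg_nonpos.2 hδ.le)]
  · linarith [Real.one_le_rpow h hδ.le]

theorem integrableOn_stableBound (hδα : δ < α) (hδα' : δ < 1 - α) :
    IntegrableOn (stableBound α δ r) (Ioi 0) := by
  refine Integrable.const_mul ?_ _
  rw [← Ioc_union_Ioi_eq_Ioi zero_le_one]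
  refine IntegrableOn.union ?_ ?_
  · have h1 : IntegrableOn (fun u : ℝ => u ^ (-α - δ)) (Ioc 0 1) :=
      (intervalIntegrable_iff_integrableOn_Ioc_of_le zero_le_one).1
        (intervalIntegral.intervalIntegrable_rpow' (by linarith))
    exact h1.congr_fun (fun u hu => by simp [hu.2]) measurableSet_Ioc
  · have h1 : IntegrableOn (fun u : ℝ => u ^ (δ - 1 - α)) (Ioi 1) :=
      integrableOn_Ioi_rpow_of_lt (by linarith) one_pos
    exact h1.congr_fun (fun u hu => by simp [not_le.2 (mem_Ioi.1 hu)]) measurableSet_Ioi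

theorem integrableOn_stableDensity (hα₀ : 0 < α) (hα₁ : α < 1) (hr : 0 ≤ r) :
    IntegrableOn (stableDensity α r) (Ioi 0) := by
  obtain ⟨δ, hδ, h1⟩ := exists_between (lt_min hα₀ (sub_pos.2 hα₁))
  have h2 := h1.trans_le (min_le_left _ _)
  have h3 := h1.trans_le (min_le_right _ _)
  refine Integrable.mono' (integrableOn_stableBound (r := r) h2 h3)
    measurable_stableDensity.aestronglyMeasurable ?_
  refine (ae_restrict_iff' measurableSet_Ioi).2 (ae_of_all _ fun u hu => ?_)
  rw [Real.norm_of_nonneg (stableDensity_nonneg hr (le_of_lt hu))]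
  exact stableDensity_le hr hδ h2.le h3.le hu

/-- Integration by parts against the antiderivative `-t^{-α} / α` reduces this to a Gamma integral.
The boundary terms vanish, being at most a constant times `t^{1-α}` near 0 and `t^{-α}` at infinity.
-/
theorem integral_stableDensity (hα₀ : 0 < α) (hα₁ : α < 1) (hr : 0 < r) :
    ∫ u : ℝ in Ioi 0, stableDensity α r u = r ^ α * Real.Gamma (1 - α) / α := by
  have hg : ∫ t : ℝ in Ioi 0, t ^ (-α) * Real.exp (-(r * t)) =
      (1 / r) ^ (1 - α) * Real.Gamma (1 - α) := by
    have := Real.integral_rpow_mul_exp_neg_mul_Ioi (a := 1 - α) (by linarith) hr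
    rwa [show 1 - α - 1 = -α by ring] at this
  have hΓ : 0 < Real.Gamma (1 - α) := Real.Gamma_pos_of_pos (by linarith)
  have hgi : IntegrableOn (fun t : ℝ => t ^ (-α) * Real.exp (-(r * t))) (Ioi 0) :=
    Integrable.of_integral_ne_zero (by rw [hg]; positivity)
  have hfun : ∀ t : ℝ, r * Real.exp (-(r * t)) * (-t ^ (-α) / α) =
      -(r / α) * (t ^ (-α) * Real.exp (-(r * t))) := fun t => by ring
  have parts := integral_Ioi_mul_deriv_eq_deriv_mul (a := 0) (a' := 0) (b' := 0)
    (u := fun t => 1 - Real.exp (-(r * t))) (u' := fun t => r * Real.exp (-(r * t)))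
    (v := fun t => -t ^ (-α) / α) (v' := fun t => t ^ (-1 - α)) ?_ ?_ ?_ ?_ ?_ ?_
  · simp only [hfun] at parts
    rw [integral_const_mul, hg] at parts
    simp only [stableDensity]
    simp_rw [mul_comm (_ ^ (-1 - α))]
    rw [parts, Real.div_rpow zero_le_one hr.le, Real.one_rpow, Real.rpow_sub hr, Real.rpow_one]
    have := Real.rpow_pos_of_pos hr α
    field_simp
    ring
  · intro t _
    have h1 : HasDerivAt (fun t => -(r * t)) (-(r * 1)) t := ((hasDerivAt_id t).const_mul r).neg
    convert! h1.exp.const_sub 1 using 1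
    ring
  · intro t ht
    have h1 := ((Real.hasDerivAt_rpow_const (p := -α) (Or.inl (ne_of_gt ht))).neg).div_const α
    convert! h1 using 1
    rw [show -1 - α = -α - 1 by ring]
    field_simp
  · exact (integrableOn_stableDensity hα₀ hα₁ hr.le).congr_fun
      (fun t _ => by simp [stableDensity, mul_comm]) measurableSet_Ioi
  · exact IntegrableOn.congr_fun (hgi.const_mul (-(r / α))) (fun t _ => (hfun t).symm) measurableSet_Ioi
  · have h1 : Tendsto (fun t : ℝ => r / α * t ^ (1 - α)) (𝓝[>] 0) (𝓝 0) := by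
      have := (Real.continuousAt_rpow_const 0 (1 - α) (Or.inr (by linarith))).tendsto.const_mul
        (r / α)
      rw [Real.zero_rpow (by linarith), mul_zero] at this
      exact this.mono_left nhdsWithin_le_nhds
    refine squeeze_zero_norm' ?_ h1
    filter_upwards [self_mem_nhdsWithin] with t (ht : 0 < t)
    have e := one_sub_exp_neg_nonneg (mul_pos hr ht).le
    have e' := Real.rpow_nonneg ht.le (-α)
    rw [Pi.mul_apply, norm_mul, Real.norm_of_nonneg e, norm_div, norm_neg,
      Real.norm_of_nonneg e', Real.norm_of_nonneg hα₀.le]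
    calc _ ≤ (r * t ^ (1 : ℝ)) * (t ^ (-α) / α) := by
          rw [Real.rpow_one]
          gcongr
          exact one_sub_exp_neg_le _
      _ = _ := by
          rw [sub_eq_add_neg, Real.rpow_add ht]
          ring
  · have h1 : Tendsto (fun t : ℝ => 1 / α * t ^ (-α)) atTop (𝓝 0) := by
      simpa using (tendsto_rpow_neg_atTop hα₀).const_mul (1 / α)
    refine squeeze_zero_norm' ?_ h1
    filter_upwards [eventually_gt_atTop 0] with t ht
    have e := one_sub_exp_neg_nonneg (mul_pos hr ht).le
    have e' := Real.rpow_nonneg ht.le (-α)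
    rw [Pi.mul_apply, norm_mul, Real.norm_of_nonneg e, norm_div, norm_neg,
      Real.norm_of_nonneg e', Real.norm_of_nonneg hα₀.le]
    calc _ ≤ 1 * (t ^ (-α) / α) := by
          gcongr
          exact one_sub_exp_neg_le_one _
      _ = _ := by ring

end Stable

/-- Abelian theorem: the Laplace exponent at `r / N` of the law with weights
`L n / n ^ (1 + α)`. -/
theorem IsSlowlyVarying.tendsto_rpow_div_mul_tsum {L : ℝ → ℝ} (hL : IsSlowlyVarying L) {α r : ℝ}
    (hα₀ : 0 < α) (hα₁ : α < 1) (hr : 0 < r) :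
    Tendsto (fun N : ℕ => (N : ℝ) ^ α / L N *
      ∑' n : ℕ, interarrivalWeight α L (n + 1) *
        (1 - Real.exp (-(r * ((n + 1 : ℕ) / (N : ℝ))))))
      atTop (𝓝 (r ^ α * Real.Gamma (1 - α) / α)) := by
  obtain ⟨δ, hδ, h1⟩ := exists_between (lt_min hα₀ (sub_pos.2 hα₁))
  have h2 := h1.trans_le (min_le_left _ _)
  have h3 := h1.trans_le (min_le_right _ _)
  obtain ⟨C, hC, hpot⟩ := hL.exists_forall_nat_div_le hδ
  set F : ℕ → ℕ → ℝ := fun N n => L n / L N * stableDensity α r ((n : ℝ) / N)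
  have hmeas : ∀ N : ℕ, Measurable fun u : ℝ => F N ⌈u * N⌉₊ := fun N =>
    (measurable_from_nat (f := F N)).comp (Nat.measurable_ceil.comp (measurable_id.mul_const _))
  have hbound : ∀ N : ℕ, 1 ≤ N → ∀ᵐ u : ℝ ∂(volume.restrict (Ioi (0 : ℝ))),
      ‖F N ⌈u * N⌉₊‖ ≤ C * stableBound α δ r u := by
    intro N hN
    have hN0 : (0 : ℝ) < N := by exact_mod_cast hN
    refine (ae_restrict_iff' measurableSet_Ioi).2 (ae_of_all _ fun u (hu : 0 < u) => ?_)
    have hc : 0 < ⌈u * N⌉₊ := Nat.ceil_pos.2 (by positivity)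
    have hle : u ≤ (⌈u * N⌉₊ : ℝ) / N := (le_div_iff₀ hN0).2 (Nat.le_ceil _)
    have hd := stableDensity_nonneg (α := α) hr.le (hu.le.trans hle)
    have hL0 : 0 ≤ L ⌈u * N⌉₊ / L N :=
      div_nonneg (hL.pos _ (by exact_mod_cast hc)).le (hL.pos _ hN0).le
    rw [Real.norm_of_nonneg (mul_nonneg hL0 hd)]
    calc _ ≤ C * (((⌈u * N⌉₊ : ℝ) / N) ^ δ + ((⌈u * N⌉₊ : ℝ) / N) ^ (-δ)) *
          stableDensity α r ((⌈u * N⌉₊ : ℝ) / N) :=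
          mul_le_mul_of_nonneg_right (hpot _ _ hc hN) hd
      _ ≤ _ := by
          rw [mul_assoc]
          exact mul_le_mul_of_nonneg_left
            (add_rpow_mul_stableDensity_le hr.le hδ h2.le h3.le hu hle) hC.le
  have hGi : Integrable (fun u => C * stableBound α δ r u) (volume.restrict (Ioi 0)) :=
    (integrableOn_stableBound h2 h3).const_mul C
  have hlim : Tendsto (fun N : ℕ => ∫ u : ℝ in Ioi 0, F N ⌈u * N⌉₊) atTop
      (𝓝 (∫ u : ℝ in Ioi 0, stableDensity α r u)) := by
    refine tendsto_integral_filter_of_dominated_convergence (fun u => C * stableBound α δ r u)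
      (Eventually.of_forall fun N => (hmeas N).aestronglyMeasurable)
      ((eventually_ge_atTop 1).mono hbound) hGi ?_
    refine (ae_restrict_iff' measurableSet_Ioi).2 (ae_of_all _ fun u (hu : 0 < u) => ?_)
    have hc : Tendsto (fun N : ℕ => (⌈u * N⌉₊ : ℝ) / N) atTop (𝓝 u) :=
      (tendsto_nat_ceil_mul_div_atTop hu.le).comp tendsto_natCast_atTop_atTop
    have hct : Tendsto (fun N : ℕ => (⌈u * N⌉₊ : ℝ)) atTop atTop :=
      tendsto_atTop_mono (fun N => Nat.le_ceil _)
        (tendsto_natCast_atTop_atTop.const_mul_atTop hu)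
    have e1 := hL.tendsto_div_of_tendsto_div hu tendsto_natCast_atTop_atTop hct hc
    have e2 := (continuousAt_stableDensity (α := α) (r := r) hu).tendsto.comp hc
    simpa using e1.mul e2
  rw [integral_stableDensity hα₀ hα₁ hr] at hlim
  refine hlim.congr' ?_
  filter_upwards [eventually_ge_atTop 1] with N hN
  have hN0 : (0 : ℝ) < N := by exact_mod_cast hN
  have hs := hasSum_integral_comp_natCeil (f := F N) hN0
    (hGi.mono' (hmeas N).aestronglyMeasurable (hbound N hN))
  rw [← hs.tsum_eq, ← tsum_mul_left]
  congr 1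
  ext n
  have hn : (0 : ℝ) < (n + 1 : ℕ) := by positivity
  have hNα := Real.rpow_pos_of_pos hN0 α
  have hnα := Real.rpow_pos_of_pos hn α
  simp only [F, stableDensity, interarrivalWeight]
  rw [Real.div_rpow hn.le hN0.le, show -1 - α = -(1 + α) by ring, Real.rpow_neg hn.le,
    Real.rpow_neg hN0.le, Real.rpow_add hN0, Real.rpow_one]
  push_cast
  field_simp

/-! ### From Laplace transforms to convergence in law -/

theorem integrable_pow_of_ae_mem_Icc {ν : Measure ℝ} [IsFiniteMeasure ν]
    (h : ∀ᵐ x ∂ν, x ∈ Icc (0 : ℝ) 1) (n : ℕ) : Integrable (fun x => x ^ n) ν := by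
  refine Integrable.of_bound (measurable_id.pow_const n).aestronglyMeasurable 1 ?_
  filter_upwards [h] with x hx
  rw [norm_pow, Real.norm_of_nonneg hx.1]
  exact pow_le_one₀ hx.1 hx.2

/-- The method of moments for probability measures carried by `[0, 1]`. -/
theorem tendsto_probabilityMeasure_of_tendsto_moments {ι : Type*} {l : Filter ι}
    {ν : ι → ProbabilityMeasure ℝ} {ν' : ProbabilityMeasure ℝ}
    (h : ∀ i, ∀ᵐ x ∂(ν i : Measure ℝ), x ∈ Icc (0 : ℝ) 1)
    (h' : ∀ᵐ x ∂(ν' : Measure ℝ), x ∈ Icc (0 : ℝ) 1)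
    (hm : ∀ n : ℕ, Tendsto (fun i => ∫ x, x ^ n ∂(ν i : Measure ℝ)) l
      (𝓝 (∫ x, x ^ n ∂(ν' : Measure ℝ)))) :
    Tendsto ν l (𝓝 ν') := by
  rw [ProbabilityMeasure.tendsto_iff_forall_integral_tendsto]
  intro f
  rw [Metric.tendsto_nhds]
  intro ε hε
  obtain ⟨p, hp⟩ := exists_polynomial_near_of_continuousOn 0 1 f f.continuous.continuousOn (ε / 4)
    (by positivity)
  have hpe : ∀ x, p.eval x = ∑ i ∈ Finset.range (p.natDegree + 1), p.coeff i * x ^ i :=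
    fun x => Polynomial.eval_eq_sum_range x
  have hpi : ∀ (ν : ProbabilityMeasure ℝ), (∀ᵐ x ∂(ν : Measure ℝ), x ∈ Icc (0 : ℝ) 1) →
      Integrable (fun x => p.eval x) (ν : Measure ℝ) := by
    intro ν hν
    simp only [hpe]
    exact integrable_finsetSum _ fun i _ => (integrable_pow_of_ae_mem_Icc hν i).const_mul _
  have hpint : ∀ (ν : ProbabilityMeasure ℝ), (∀ᵐ x ∂(ν : Measure ℝ), x ∈ Icc (0 : ℝ) 1) →
      ∫ x, p.eval x ∂(ν : Measure ℝ) =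
        ∑ i ∈ Finset.range (p.natDegree + 1), p.coeff i * ∫ x, x ^ i ∂(ν : Measure ℝ) := by
    intro ν hν
    simp only [hpe]
    rw [integral_finsetSum _ fun i _ => (integrable_pow_of_ae_mem_Icc hν i).const_mul _]
    simp only [integral_const_mul]
  have hnear : ∀ (ν : ProbabilityMeasure ℝ), (∀ᵐ x ∂(ν : Measure ℝ), x ∈ Icc (0 : ℝ) 1) →
      |∫ x, p.eval x ∂(ν : Measure ℝ) - ∫ x, f x ∂(ν : Measure ℝ)| ≤ ε / 4 := by
    intro ν hν
    rw [← integral_sub (hpi ν hν) (f.integrable _)]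
    have := norm_integral_le_of_norm_le_const (μ := (ν : Measure ℝ))
      (f := fun x => p.eval x - f x) (C := ε / 4) (hν.mono fun x hx => (hp x hx).le)
    simpa using this
  have hpt : Tendsto (fun i => ∫ x, p.eval x ∂(ν i : Measure ℝ)) l
      (𝓝 (∫ x, p.eval x ∂(ν' : Measure ℝ))) := by
    rw [hpint ν' h']
    simp_rw [fun i => hpint (ν i) (h i)]
    exact tendsto_finsetSum _ fun i _ => (hm i).const_mul _
  filter_upwards [Metric.tendsto_nhds.1 hpt (ε / 4) (by positivity)] with i hi
  have e1 := abs_le.1 (hnear (ν i) (h i))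
  have e2 := abs_le.1 (hnear ν' h')
  rw [Real.dist_eq, abs_lt] at *
  constructor <;> linarith

/-- Convergence of the Laplace transforms of nonnegative random variables at the positive integers
implies convergence of the distribution functions at points which are not atoms of the limit. -/
theorem tendsto_measureReal_le_of_tendsto_mgf {ι Ω Ω' : Type*} [MeasurableSpace Ω]
    [MeasurableSpace Ω'] {μ : Measure Ω} [IsProbabilityMeasure μ] {P : Measure Ω'}
    [IsProbabilityMeasure P] {l : Filter ι} {X : ι → Ω → ℝ} {Y : Ω' → ℝ}
    (hX : ∀ i, Measurable (X i)) (hX0 : ∀ i, ∀ᵐ ω ∂μ, 0 ≤ X i ω) (hY : Measurable Y)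
    (hY0 : ∀ᵐ ω ∂P, 0 ≤ Y ω)
    (hlap : ∀ n : ℕ, 1 ≤ n → Tendsto (fun i => mgf (X i) μ (-n)) l (𝓝 (mgf Y P (-n))))
    {c : ℝ} (hc : P {ω | Y ω = c} = 0) :
    Tendsto (fun i => μ.real {ω | X i ω ≤ c}) l (𝓝 (P.real {ω | Y ω ≤ c})) := by
  have hXm : ∀ i, Measurable fun ω => Real.exp (-X i ω) := fun i => (hX i).neg.exp
  have hYm : Measurable fun ω => Real.exp (-Y ω) := hY.neg.exp
  let ν : ι → ProbabilityMeasure ℝ := fun i =>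
    ⟨μ.map fun ω => Real.exp (-X i ω), Measure.isProbabilityMeasure_map (hXm i).aemeasurable⟩
  let ν' : ProbabilityMeasure ℝ :=
    ⟨P.map fun ω => Real.exp (-Y ω), Measure.isProbabilityMeasure_map hYm.aemeasurable⟩
  have hpow : ∀ (n : ℕ) (x : ℝ), Real.exp (-x) ^ n = Real.exp (-(n : ℝ) * x) := fun n x => by
    rw [← Real.exp_nat_mul]
    ring_nf
  have hconv : Tendsto ν l (𝓝 ν') := by
    refine tendsto_probabilityMeasure_of_tendsto_moments (fun i => ?_) ?_ fun n => ?_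
    · refine (ae_map_iff (hXm i).aemeasurable measurableSet_Icc).2 ?_
      filter_upwards [hX0 i] with ω hω
      exact ⟨(Real.exp_pos _).le, Real.exp_le_one_iff.2 (neg_nonpos.2 hω)⟩
    · refine (ae_map_iff hYm.aemeasurable measurableSet_Icc).2 ?_
      filter_upwards [hY0] with ω hω
      exact ⟨(Real.exp_pos _).le, Real.exp_le_one_iff.2 (neg_nonpos.2 hω)⟩
    · rcases Nat.eq_zero_or_pos n with rfl | hn
      · simpa using tendsto_const_nhds
      have e1 : ∀ i, ∫ x, x ^ n ∂(ν i : Measure ℝ) = mgf (X i) μ (-n) := fun i => by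
        simp only [ν, mgf, ProbabilityMeasure.coe_mk]
        rw [integral_map (hXm i).aemeasurable (by fun_prop)]
        simp only [hpow]
      have e2 : ∫ x, x ^ n ∂(ν' : Measure ℝ) = mgf Y P (-n) := by
        simp only [ν', mgf, ProbabilityMeasure.coe_mk]
        rw [integral_map hYm.aemeasurable (by fun_prop)]
        simp only [hpow]
      simp only [e1, e2]
      exact hlap n hn
  -- `X ≤ c` means `e^{-X} ≥ e^{-c}`, and the frontier of this half-line is the single point
  -- `e^{-c}`, null because `c` is not an atom of `Y`.
  have key := ProbabilityMeasure.tendsto_measure_of_null_frontier_of_tendsto' hconv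
    (E := Ici (Real.exp (-c))) (by
      rw [frontier_Ici]
      simp only [ν', ProbabilityMeasure.coe_mk]
      rw [Measure.map_apply hYm (measurableSet_singleton _)]
      convert! hc using 2
      ext ω
      simp)
  have key' := (ENNReal.tendsto_toReal (measure_ne_top _ _)).comp key
  convert! key' using 2
  · simp only [ν, ProbabilityMeasure.coe_mk, Function.comp, Measure.real]
    rw [Measure.map_apply (hXm _) measurableSet_Ici]
    congr 2
    ext ω
    simp
  · simp only [ν', ProbabilityMeasure.coe_mk, Measure.real]
    rw [Measure.map_apply hYm measurableSet_Ici]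
    congr 2
    ext ω
    simp

theorem tendsto_one_sub_pow_exp_neg {k : ℕ → ℕ} {p : ℕ → ℝ} {y : ℝ} (hk : Tendsto k atTop atTop)
    (hp : Tendsto (fun n => k n * p n) atTop (𝓝 y)) :
    Tendsto (fun n => (1 - p n) ^ k n) atTop (𝓝 (Real.exp (-y))) := by
  have hkR : Tendsto (fun n => (k n : ℝ)) atTop atTop := tendsto_natCast_atTop_atTop.comp hk
  have hp0 : Tendsto p atTop (𝓝 0) := by
    refine (hp.div_atTop hkR).congr' ?_
    filter_upwards [hkR.eventually_gt_atTop 0] with n hn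
    field_simp
  have hlog : Tendsto (fun n => k n * Real.log (1 - p n)) atTop (𝓝 (-y)) := by
    have hl : Tendsto (fun n => -(k n * p n) / (1 - p n)) atTop (𝓝 (-y)) := by
      have := hp.neg.div (hp0.const_sub 1) (by simp)
      rwa [sub_zero, div_one] at this
    -- Squeeze by `1 - 1/z ≤ log z ≤ z - 1` at `z = 1 - p n`.
    refine tendsto_of_tendsto_of_tendsto_of_le_of_le' hl hp.neg ?_ ?_
    all_goals
      filter_upwards [hp0.eventually_lt_const one_pos] with n hn
      have h1 : 0 < 1 - p n := by linarith
    · have := mul_le_mul_of_nonneg_left (Real.one_sub_inv_le_log_of_pos h1)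
        (Nat.cast_nonneg (α := ℝ) (k n))
      refine le_trans (le_of_eq ?_) this
      field_simp
      ring
    · have := mul_le_mul_of_nonneg_left (Real.log_le_sub_one_of_pos h1)
        (Nat.cast_nonneg (α := ℝ) (k n))
      linarith
  refine ((Real.continuous_exp.tendsto _).comp hlog).congr' ?_
  filter_upwards [hp0.eventually_lt_const one_pos] with n hn
  have h1 : 0 < 1 - p n := by linarith
  simp only [Function.comp]
  rw [← Real.log_pow, Real.exp_log (pow_pos h1 _)]

/-- The sublevel sets of `renewalCount` and `localTime` are identified with measurable events only
almost surely, hence null measurability. -/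
theorem aemeasurable_of_nullMeasurableSet_le {Ω β : Type*} [MeasurableSpace Ω] {μ : Measure Ω}
    [TopologicalSpace β] [MeasurableSpace β] [BorelSpace β] [LinearOrder β] [OrderTopology β]
    [SecondCountableTopology β] [Nonempty β] {f : Ω → β}
    (h : ∀ x, NullMeasurableSet {ω | f ω ≤ x} μ) : AEMeasurable f μ := by
  have : NullMeasurable f μ :=
    measurable_of_Iic (δ := NullMeasurableSpace Ω μ) h
  exact this.aemeasurable

/-- Convergence of the distribution functions on a dense set implies convergence in law. -/
theorem tendsto_probabilityMeasure_of_tendsto_Iic {ν : ℕ → ProbabilityMeasure ℝ}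
    {ν' : ProbabilityMeasure ℝ} {D : Set ℝ} (hD : Dense D)
    (h : ∀ x ∈ D, Tendsto (fun i => (ν i : Measure ℝ).real (Iic x)) atTop
      (𝓝 ((ν' : Measure ℝ).real (Iic x)))) :
    Tendsto ν atTop (𝓝 ν') := by
  refine IsPiSystem.tendsto_probabilityMeasure_of_tendsto_of_mem
    (S := {s | ∃ p ∈ D, ∃ q ∈ D, s = Ioc p q}) ?_ ?_ ?_ ?_
  · rintro _ ⟨p, hp, q, hq, rfl⟩ _ ⟨p', hp', q', hq', rfl⟩ _
    refine ⟨max p p', ?_, min q q', ?_, Ioc_inter_Ioc⟩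
    · rcases max_choice p p' with h | h <;> rwa [h]
    · rcases min_choice q q' with h | h <;> rwa [h]
  · rintro _ ⟨p, _, q, _, rfl⟩
    exact measurableSet_Ioc
  · intro u hu x hx
    obtain ⟨a, b, hab, hsub⟩ := (mem_nhds_iff_exists_Ioo_subset.1 (hu.mem_nhds hx))
    obtain ⟨p, hp, hp'⟩ := hD.exists_between hab.1
    obtain ⟨q, hq, hq'⟩ := hD.exists_between hab.2
    exact ⟨Ioc p q, ⟨p, hp, q, hq, rfl⟩, Ioc_mem_nhds hp'.2 hq'.1,
      fun y hy => hsub ⟨hp'.1.trans hy.1, hy.2.trans_lt hq'.2⟩⟩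
  · rintro _ ⟨p, hp, q, hq, rfl⟩
    rcases le_total q p with hqp | hpq
    · simp [Ioc_eq_empty_of_le hqp]
    · have hdiff : ∀ ν : ProbabilityMeasure ℝ, ((ν (Ioc p q) : ℝ≥0) : ℝ) =
          (ν : Measure ℝ).real (Iic q) - (ν : Measure ℝ).real (Iic p) := by
        intro ν
        rw [← measureReal_sdiff (Iic_subset_Iic.2 hpq) measurableSet_Iic, Iic_sdiff_Iic]
        rfl
      rw [← NNReal.tendsto_coe]
      simp only [hdiff]
      exact (h q hq).sub (h p hp)

/-! ### Renewal counts and interarrival sums -/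

/-- The indices `j` with `S j ≤ N` form an initial segment of `ℕ`, of length the count. The epoch `S
0 = 0` is counted, which is why the index on the right is `k` and not `k + 1`. -/
theorem renewalCount_le_iff {Ω : Type*} {l : ℕ → Ω → ℕ} {ω : Ω} (h : ∀ i, 0 < l i ω) (N k : ℕ) :
    renewalCount l N ω ≤ k ↔ N < ∑ i ∈ Finset.range k, l i ω := by
  set S : ℕ → ℕ := fun k => ∑ i ∈ Finset.range k, l i ω
  have hS : StrictMono S := strictMono_nat_of_lt_succ fun k => by
    simp only [S, Finset.sum_range_succ]
    exact Nat.lt_add_of_pos_right (h k)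
  have hcount : renewalCount l N ω = {j | S j ≤ N}.ncard := by
    have : renewalSet l ω ∩ Iic N = S '' {j | S j ≤ N} := by
      ext m
      constructor
      · rintro ⟨⟨j, rfl⟩, hj⟩
        exact ⟨j, hj, rfl⟩
      · rintro ⟨j, hj, rfl⟩
        exact ⟨⟨j, rfl⟩, hj⟩
    rw [renewalCount, this, ncard_image_of_injective _ hS.injective]
  have hfin : {j | S j ≤ N}.Finite :=
    (finite_Iic N).subset fun j (hj : S j ≤ N) => (hS.le_apply).trans hj
  rw [hcount]
  change _ ↔ N < S k
  constructor
  · intro hle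
    by_contra! hcon
    have hsub : Iic k ⊆ {j | S j ≤ N} := fun j hj => (hS.monotone hj).trans hcon
    have := (ncard_le_ncard hsub hfin).trans hle
    rw [← Finset.coe_Iic, ncard_coe_finset, Nat.card_Iic] at this
    omega
  · intro hlt
    have hsub : {j | S j ≤ N} ⊆ Iio k := fun j (hj : S j ≤ N) => by
      by_contra hcon
      have := hS.monotone (not_lt.1 hcon)
      omega
    have := ncard_le_ncard hsub (finite_Iio k)
    rwa [← Finset.coe_Iio, ncard_coe_finset, Nat.card_Iio] at this

theorem IsInterarrivalSequence.measurable_sum {Ω : Type*} [MeasurableSpace Ω] {μ : Measure Ω}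
    {l : ℕ → Ω → ℕ} {K : ℕ → ℝ} (hl : IsInterarrivalSequence K l μ) (k : ℕ) :
    Measurable fun ω => ∑ i ∈ Finset.range k, l i ω :=
  Finset.measurable_fun_sum _ fun i _ => hl.measurable i

section Renewal

variable {Ω : Type*} [MeasurableSpace Ω] {μ : Measure Ω} [IsProbabilityMeasure μ] {l : ℕ → Ω → ℕ}
  {K : ℕ → ℝ}

namespace IsInterarrivalSequence

theorem integral_comp (hl : IsInterarrivalSequence K l μ) (hrec : HasSum (fun n => K (n + 1)) 1)
    (i : ℕ) {f : ℕ → ℝ} (hf : ∀ n, |f n| ≤ 1) :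
    ∫ ω, f (l i ω) ∂μ = μ.real {ω | l i ω = 0} * f 0 + ∑' n, K (n + 1) * f (n + 1) := by
  have hfm : Measurable f := measurable_from_nat
  have hreal : ∀ n, (μ.map (l i)).real {n} = μ.real {ω | l i ω = n} := fun n => by
    rw [map_measureReal_apply (hl.measurable i) (measurableSet_singleton n)]
    rfl
  have : IsProbabilityMeasure (μ.map (l i)) :=
    Measure.isProbabilityMeasure_map (hl.measurable i).aemeasurable
  have hK : ∀ n, 0 ≤ K (n + 1) := fun n => by
    rw [← hl.law i (n + 1) (by omega)]
    exact measureReal_nonneg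
  have hsum : Summable fun n => K (n + 1) * f (n + 1) :=
    Summable.of_norm_bounded hrec.summable fun n => by
      rw [norm_mul, Real.norm_of_nonneg (hK n)]
      exact mul_le_of_le_one_right (hK n) (hf _)
  rw [← integral_map (hl.measurable i).aemeasurable hfm.aestronglyMeasurable,
    integral_countable (Integrable.of_bound hfm.aestronglyMeasurable 1 (ae_of_all _ hf)),
    Summable.tsum_eq_zero_add ((summable_nat_add_iff 1).1 (hsum.congr fun n => by
      rw [hreal, hl.law i (n + 1) (by omega), smul_eq_mul]))]
  simp only [hreal, smul_eq_mul]
  congr 2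
  ext n
  rw [hl.law i (n + 1) (by omega)]

/-- `law` does not mention the value 0; the masses at `n ≥ 1` already sum to one, leaving none for
it. -/
theorem measureReal_eq_zero (hl : IsInterarrivalSequence K l μ)
    (hrec : HasSum (fun n => K (n + 1)) 1) (i : ℕ) : μ.real {ω | l i ω = 0} = 0 := by
  have := hl.integral_comp hrec i (f := fun _ => 1) (by simp)
  simp only [mul_one, integral_const, probReal_univ, smul_eq_mul, hrec.tsum_eq] at this
  linarith

theorem ae_pos (hl : IsInterarrivalSequence K l μ) (hrec : HasSum (fun n => K (n + 1)) 1) :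
    ∀ᵐ ω ∂μ, ∀ i, 0 < l i ω := by
  refine ae_all_iff.2 fun i => ?_
  have := (measureReal_eq_zero_iff (measure_ne_top _ _)).1 (hl.measureReal_eq_zero hrec i)
  refine measure_mono_null (fun ω hω => ?_) this
  exact Nat.eq_zero_of_not_pos hω

theorem mgf_eq (hl : IsInterarrivalSequence K l μ) (hrec : HasSum (fun n => K (n + 1)) 1)
    (i : ℕ) {r : ℝ} (hr : 0 ≤ r) :
    mgf (fun ω => (l i ω : ℝ)) μ (-r) =
      1 - ∑' n : ℕ, K (n + 1) * (1 - Real.exp (-(r * (n + 1 : ℕ)))) := by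
  have h0 : ∀ n : ℕ, 0 ≤ r * n := fun n => by positivity
  -- The test function vanishes at 0, so a mass at 0 would not contribute.
  have h1 := hl.integral_comp hrec i (f := fun n => 1 - Real.exp (-(r * n))) fun n => by
    rw [abs_of_nonneg (one_sub_exp_neg_nonneg (h0 n))]
    exact one_sub_exp_neg_le_one _
  rw [integral_sub (integrable_const _)] at h1
  · simp only [integral_const, probReal_univ, smul_eq_mul, mul_one, Nat.cast_zero, mul_zero,
      neg_zero, Real.exp_zero, sub_self, zero_add] at h1
    rw [← h1]
    simp [mgf]
  · refine Integrable.of_bound (measurable_from_nat.comp (hl.measurable i)).aestronglyMeasurable 1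
      (ae_of_all _ fun ω => ?_) (f := (fun n : ℕ => Real.exp (-(r * n))) ∘ l i)
    simp only [Function.comp, Real.norm_eq_abs, Real.abs_exp, Real.exp_le_one_iff]
    linarith [h0 (l i ω)]

theorem mgf_sum_eq (hl : IsInterarrivalSequence K l μ) (hrec : HasSum (fun n => K (n + 1)) 1)
    (k : ℕ) {r : ℝ} (hr : 0 ≤ r) :
    mgf (fun ω => ((∑ i ∈ Finset.range k, l i ω : ℕ) : ℝ)) μ (-r) =
      (1 - ∑' n : ℕ, K (n + 1) * (1 - Real.exp (-(r * (n + 1 : ℕ))))) ^ k := by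
  have hind : iIndepFun (fun i ω => (l i ω : ℝ)) μ :=
    hl.indep.comp (fun _ (n : ℕ) => (n : ℝ)) fun _ => measurable_from_nat
  have := hind.mgf_sum (t := -r) (fun i => measurable_from_nat.comp (hl.measurable i))
    (Finset.range k)
  simp only [hl.mgf_eq hrec _ hr, Finset.prod_const, Finset.card_range] at this
  rw [← this]
  congr 1
  ext ω
  simp

end IsInterarrivalSequence

theorem IsInterarrivalSequence.aemeasurable_renewalCount (hl : IsInterarrivalSequence K l μ)
    (hrec : HasSum (fun n => K (n + 1)) 1) (N : ℕ) : AEMeasurable (renewalCount l N) μ := by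
  refine aemeasurable_of_nullMeasurableSet_le fun k => ?_
  have : MeasurableSet {ω | N < ∑ i ∈ Finset.range k, l i ω} :=
    measurableSet_lt measurable_const (hl.measurable_sum k)
  refine this.nullMeasurableSet.congr ?_
  filter_upwards [hl.ae_pos hrec] with ω hω
  exact propext (renewalCount_le_iff hω N k).symm

end Renewal

/-! ### Asymptotics of the normalizing sequences -/

section Normalization

/-- No monotonicity of `a` is needed: its values on indices below `M` are bounded by a finite sum.
-/
theorem tendsto_atTop_of_comp_tendsto_atTop {a : ℕ → ℝ} {f : ℕ → ℕ}
    (h : Tendsto (fun n => a (f n)) atTop atTop) : Tendsto f atTop atTop := by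
  refine tendsto_atTop.2 fun M => ?_
  filter_upwards [h.eventually_gt_atTop (∑ i ∈ Finset.range M, |a i|)] with n hn
  by_contra! hlt
  have := Finset.single_le_sum (f := fun i => |a i|) (fun _ _ => abs_nonneg _)
    (Finset.mem_range.2 hlt)
  linarith [le_abs_self (a (f n))]

variable {α : ℝ} {L : ℝ → ℝ} {a b : ℕ → ℝ}

theorem IsAsymptoticInverse.tendsto_comp_atTop (hb : IsAsymptoticInverse a b) :
    Tendsto (fun n => a ⌊b n⌋₊) atTop atTop :=
  hb.left.symm.tendsto_atTop tendsto_natCast_atTop_atTop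

theorem IsAsymptoticInverse.tendsto_floor (hb : IsAsymptoticInverse a b) :
    Tendsto (fun n => ⌊b n⌋₊) atTop atTop :=
  tendsto_atTop_of_comp_tendsto_atTop hb.tendsto_comp_atTop

theorem IsAsymptoticInverse.tendsto_atTop (hb : IsAsymptoticInverse a b) :
    Tendsto b atTop atTop := by
  refine tendsto_atTop_mono' _ ?_ (tendsto_natCast_atTop_atTop.comp hb.tendsto_floor)
  filter_upwards [hb.tendsto_floor.eventually_ge_atTop 1] with n hn
  exact Nat.floor_le (Nat.pos_of_floor_pos hn).le

/-- The asymptotic inverse satisfies `b N ∼ α N ^ α / (Γ(1 - α) L N)`. -/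
theorem IsAsymptoticInverse.tendsto_mul_div_rpow (hL : IsSlowlyVarying L) (hα₀ : 0 < α)
    (hα₁ : α < 1) (ha : IsStableNormalizing α L a) (hb : IsAsymptoticInverse a b) :
    Tendsto (fun N : ℕ => b N * (L N / (N : ℝ) ^ α)) atTop (𝓝 (α / Real.Gamma (1 - α))) := by
  have hΓ : 0 < Real.Gamma (1 - α) := Real.Gamma_pos_of_pos (by linarith)
  have hat := hb.tendsto_comp_atTop
  have hratio : Tendsto (fun N : ℕ => a ⌊b N⌋₊ / N) atTop (𝓝 1) := by
    refine (Asymptotics.isEquivalent_iff_tendsto_one ?_).1 hb.left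
    filter_upwards [eventually_ge_atTop 1] with N hN
    positivity
  have hLr := hL.tendsto_div_of_tendsto_div one_pos tendsto_natCast_atTop_atTop hat hratio
  have hpow := hratio.rpow_const (p := α) (Or.inl one_ne_zero)
  have hfl : Tendsto (fun N => (⌊b N⌋₊ : ℝ) / b N) atTop (𝓝 1) :=
    tendsto_nat_floor_div_atTop.comp hb.tendsto_atTop
  have hone := ha.tendsto_one.comp hb.tendsto_floor
  -- Start from the normalization of `a` at index `⌊b N⌋`, then replace `a ⌊b N⌋` by `N` in the
  -- power and in `L`, and `⌊b N⌋` by `b N`.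
  have hlim := (((hone.mul hpow).div hLr one_ne_zero).div hfl one_ne_zero).mul_const
    (α / Real.Gamma (1 - α))
  rw [Real.one_rpow, mul_one, div_one, div_one, one_mul] at hlim
  refine hlim.congr' ?_
  filter_upwards [eventually_ge_atTop 1, hat.eventually_gt_atTop 0,
    hb.tendsto_atTop.eventually_gt_atTop 0, hb.tendsto_floor.eventually_ge_atTop 1]
    with N hN haN hbN hfN
  have hN0 : (0 : ℝ) < N := by exact_mod_cast hN
  have hf0 : (0 : ℝ) < ⌊b N⌋₊ := by exact_mod_cast hfN
  have h1 := hL.pos _ haN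
  have h2 := hL.pos _ hN0
  have h3 := Real.rpow_pos_of_pos haN α
  have h4 := Real.rpow_pos_of_pos hN0 α
  simp only [Function.comp, Pi.div_apply]
  rw [Real.div_rpow haN.le hN0.le]
  field_simp

end Normalization

/-! ### First passage of the stable subordinator -/

/-- Right-continuity makes the infimum attained. Nonemptiness matters since `sInf ∅ = 0` in `ℝ≥0`.
-/
theorem sInf_setOf_le_le_iff {f : ℝ≥0 → ℝ} (hf : Monotone f)
    (hc : ∀ t, ContinuousWithinAt f (Ici t) t) {c : ℝ} (hne : {s | c ≤ f s}.Nonempty) (x : ℝ≥0) :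
    sInf {s | c ≤ f s} ≤ x ↔ c ≤ f x := by
  refine ⟨fun h => ?_, fun h => csInf_le' h⟩
  refine le_trans ?_ (hf h)
  have htend : Tendsto f (𝓝[>] sInf {s | c ≤ f s}) (𝓝 (f (sInf {s | c ≤ f s}))) :=
    (hc _).mono_left (nhdsWithin_mono _ Ioi_subset_Ici_self)
  refine ge_of_tendsto htend ?_
  filter_upwards [self_mem_nhdsWithin] with s hs
  obtain ⟨u, hu, hus⟩ := (csInf_lt_iff (OrderBot.bddBelow _) hne).1 (mem_Ioi.1 hs)
  exact (mem_ofPred.1 hu).trans (hf hus.le)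

theorem localTime_nonneg {Ω : Type*} (σ : ℝ≥0 → Ω → ℝ) (t : ℝ) (ω : Ω) : 0 ≤ localTime σ t ω :=
  NNReal.coe_nonneg _

namespace IsStableSubordinator

variable {Ω' : Type*} [MeasurableSpace Ω'] {P : Measure Ω'} {α : ℝ} {σ : ℝ≥0 → Ω' → ℝ}

theorem ae_nonneg (hσ : IsStableSubordinator α σ P) (t : ℝ≥0) : ∀ᵐ ω ∂P, 0 ≤ σ t ω := by
  filter_upwards [hσ.zero, hσ.monotone] with ω h0 hm
  rw [← h0]
  exact hm zero_le

theorem mgf_eq (hσ : IsStableSubordinator α σ P) {r : ℝ} (hr : 0 < r) (t : ℝ≥0) :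
    mgf (σ t) P (-r) = Real.exp (-(t : ℝ) * r ^ α) :=
  hσ.laplace r t hr

variable [IsProbabilityMeasure P]

theorem measureReal_le_le (hσ : IsStableSubordinator α σ P) {r : ℝ} (hr : 0 < r) (t : ℝ≥0)
    (c : ℝ) : P.real {ω | σ t ω ≤ c} ≤ Real.exp (r * c) * Real.exp (-(t : ℝ) * r ^ α) := by
  have := measure_le_le_exp_mul_mgf (μ := P) (X := σ t) (t := -r) c (by linarith)
    (Integrable.of_integral_ne_zero (by
      rw [hσ.laplace r t hr]
      exact (Real.exp_pos _).ne'))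
  rwa [hσ.mgf_eq hr, neg_neg] at this

/-- Let `r → ∞` in the Chernoff bound at level 0. -/
theorem measure_le_zero_eq_zero (hα : 0 < α) (hσ : IsStableSubordinator α σ P) {t : ℝ≥0}
    (ht : 0 < t) : P {ω | σ t ω ≤ 0} = 0 := by
  rw [← measureReal_eq_zero_iff]
  refine le_antisymm ?_ measureReal_nonneg
  have hlim : Tendsto (fun r : ℝ => Real.exp (-(t : ℝ) * r ^ α)) atTop (𝓝 0) := by
    refine Real.tendsto_exp_atBot.comp ?_
    exact (tendsto_rpow_atTop hα).const_mul_atTop_of_neg (neg_lt_zero.2 (NNReal.coe_pos.2 ht))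
  refine ge_of_tendsto hlim ?_
  filter_upwards [eventually_gt_atTop 0] with r hr
  simpa using hσ.measureReal_le_le hr t 0

theorem measure_eq_eq_zero (hα : 0 < α) (hσ : IsStableSubordinator α σ P) {s t : ℝ≥0}
    (hst : s < t) : P {ω | σ s ω = σ t ω} = 0 := by
  obtain ⟨h, rfl⟩ := exists_add_of_le hst.le
  have hh : 0 < h := by simpa using hst
  have hid := (hσ.stationary_increments s h).measure_mem_eq (measurableSet_Iic (a := (0 : ℝ)))
  refine measure_mono_null (fun ω hω => ?_) (hid.trans (hσ.measure_le_zero_eq_zero hα hh))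
  simp only [mem_ofPred_eq] at hω
  simp [hω]

/-- A fixed level is an atom of the law of `σ t` for at most countably many times `t`. -/
theorem countable_setOf_measure_pos (hα : 0 < α) (hσ : IsStableSubordinator α σ P) (c : ℝ) :
    {t : ℝ≥0 | 0 < P {ω | σ t ω = c}}.Countable := by
  refine Measure.countable_meas_pos_of_disjoint_iUnion₀
    (fun t => (hσ.measurable t (measurableSet_singleton c)).nullMeasurableSet) ?_
  have key : ∀ s t : ℝ≥0, s < t → P ({ω | σ s ω = c} ∩ {ω | σ t ω = c}) = 0 := fun s t hst =>
    measure_mono_null (fun ω hω => hω.1.trans hω.2.symm) (hσ.measure_eq_eq_zero hα hst)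
  intro s t hst
  rcases lt_or_gt_of_ne hst with h | h
  · exact key s t h
  · change P _ = 0
    rw [inter_comm]
    exact key t s h

/-- Chernoff with `r = 1` gives `P(σ_n ≤ c) ≤ e^{c-n}`, so paths are almost surely unbounded and the
set defining `localTime` is nonempty. -/
theorem ae_exists_le (hσ : IsStableSubordinator α σ P) (c : ℝ) :
    ∀ᵐ ω ∂P, ∃ s, c ≤ σ s ω := by
  change P _ = 0
  rw [← measureReal_eq_zero_iff]
  refine le_antisymm ?_ measureReal_nonneg
  have hlim : Tendsto (fun n : ℕ => Real.exp c * Real.exp (-(n : ℝ))) atTop (𝓝 0) := by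
    have := (Real.tendsto_exp_neg_atTop_nhds_zero.comp
      tendsto_natCast_atTop_atTop).const_mul (Real.exp c)
    simpa using this
  refine ge_of_tendsto' hlim fun n => ?_
  have h1 := hσ.measureReal_le_le one_pos n c
  simp only [one_mul, Real.one_rpow, mul_one, NNReal.coe_natCast] at h1
  refine le_trans (measureReal_mono fun ω hω => ?_) h1
  have : ¬ ∃ s, c ≤ σ s ω := hω
  push Not at this
  exact (this n).le

theorem ae_localTime_le_iff (hσ : IsStableSubordinator α σ P) (c : ℝ) :
    ∀ᵐ ω ∂P, ∀ x : ℝ≥0, localTime σ c ω ≤ x ↔ c ≤ σ x ω := by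
  filter_upwards [hσ.ae_exists_le c, hσ.monotone, hσ.right_continuous] with ω hne hm hc x
  rw [localTime, NNReal.coe_le_coe]
  exact sInf_setOf_le_le_iff hm hc hne x

theorem aemeasurable_localTime (hσ : IsStableSubordinator α σ P) (c : ℝ) :
    AEMeasurable (localTime σ c) P := by
  refine aemeasurable_of_nullMeasurableSet_le fun x => ?_
  rcases lt_or_ge x 0 with hx | hx
  · convert! nullMeasurableSet_empty using 1
    ext ω
    simpa using hx.trans_le (localTime_nonneg σ c ω)
  · have : MeasurableSet {ω | c ≤ σ ⟨x, hx⟩ ω} :=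
      measurableSet_le measurable_const (hσ.measurable _)
    refine this.nullMeasurableSet.congr ?_
    filter_upwards [hσ.ae_localTime_le_iff c] with ω hω
    exact propext (hω ⟨x, hx⟩).symm

end IsStableSubordinator

/-! ### Convergence in law -/

section Limit

variable {α : ℝ} {L : ℝ → ℝ} {Ω : Type*} [MeasurableSpace Ω] {μ : Measure Ω}
  [IsProbabilityMeasure μ] {l : ℕ → Ω → ℕ} {a b : ℕ → ℝ} {Ω' : Type*} [MeasurableSpace Ω']
  {P : Measure Ω'} [IsProbabilityMeasure P] {σ : ℝ≥0 → Ω' → ℝ}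

theorem tendsto_floor_mul_div (hb : IsAsymptoticInverse a b) {x : ℝ} (hx : 0 ≤ x) :
    Tendsto (fun N => (⌊x * b N⌋₊ : ℝ) / b N) atTop (𝓝 x) :=
  (tendsto_nat_floor_mul_div_atTop hx).comp hb.tendsto_atTop

/-- The rescaled renewal epochs converge to the stable subordinator, in terms of Laplace
transforms. -/
theorem IsInterarrivalSequence.tendsto_mgf_sum (hα₀ : 0 < α) (hα₁ : α < 1)
    (hL : IsSlowlyVarying L) (hrec : HasSum (fun n : ℕ => interarrivalWeight α L (n + 1)) 1)
    (hl : IsInterarrivalSequence (interarrivalWeight α L) l μ)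
    (ha : IsStableNormalizing α L a) (hb : IsAsymptoticInverse a b) {x r : ℝ} (hx : 0 < x)
    (hr : 0 < r) :
    Tendsto (fun N : ℕ => mgf (fun ω => ((∑ i ∈ Finset.range ⌊x * b N⌋₊, l i ω : ℕ) : ℝ) / N)
      μ (-r)) atTop (𝓝 (Real.exp (-x * r ^ α))) := by
  have hk : Tendsto (fun N => ⌊x * b N⌋₊) atTop atTop :=
    tendsto_nat_floor_atTop.comp (hb.tendsto_atTop.const_mul_atTop hx)
  have hΓ : 0 < Real.Gamma (1 - α) := Real.Gamma_pos_of_pos (by linarith)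
  have hlim := ((tendsto_floor_mul_div hb hx.le).mul
    (hb.tendsto_mul_div_rpow hL hα₀ hα₁ ha)).mul (hL.tendsto_rpow_div_mul_tsum hα₀ hα₁ hr)
  rw [show x * (α / Real.Gamma (1 - α)) * (r ^ α * Real.Gamma (1 - α) / α) = x * r ^ α by
    field_simp] at hlim
  rw [neg_mul]
  refine (tendsto_one_sub_pow_exp_neg (p := fun N : ℕ => ∑' n : ℕ,
    interarrivalWeight α L (n + 1) * (1 - Real.exp (-(r * ((n + 1 : ℕ) / (N : ℝ))))))
    hk (hlim.congr' ?_)).congr fun N => ?_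
  · filter_upwards [eventually_ge_atTop 1, hb.tendsto_atTop.eventually_gt_atTop 0] with N hN hbN
    have hN0 : (0 : ℝ) < N := by exact_mod_cast hN
    have h1 := hL.pos _ hN0
    have h2 := Real.rpow_pos_of_pos hN0 α
    field_simp
  · have hrN : 0 ≤ r / N := by positivity
    have := hl.mgf_sum_eq hrec ⌊x * b N⌋₊ hrN
    have e1 : mgf (fun ω => ((∑ i ∈ Finset.range ⌊x * b N⌋₊, l i ω : ℕ) : ℝ) / N) μ (-r) =
        mgf (fun ω => ((∑ i ∈ Finset.range ⌊x * b N⌋₊, l i ω : ℕ) : ℝ)) μ (-(r / N)) := by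
      simp only [mgf]
      congr 1
      ext ω
      congr 1
      ring
    rw [e1, this]
    congr 3
    ext n
    rw [show r * (((n + 1 : ℕ) : ℝ) / N) = r / N * (n + 1 : ℕ) by ring]

theorem IsInterarrivalSequence.tendsto_measureReal_renewalCount_div_le (hα₀ : 0 < α)
    (hα₁ : α < 1) (hL : IsSlowlyVarying L)
    (hrec : HasSum (fun n : ℕ => interarrivalWeight α L (n + 1)) 1)
    (hl : IsInterarrivalSequence (interarrivalWeight α L) l μ)
    (ha : IsStableNormalizing α L a) (hb : IsAsymptoticInverse a b)
    (hσ : IsStableSubordinator α σ P) {x : ℝ≥0} (hx : 0 < x) (hatom : P {ω | σ x ω = 1} = 0) :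
    Tendsto (fun N : ℕ => μ.real {ω | (renewalCount l N ω : ℝ) / b N ≤ x}) atTop
      (𝓝 (P.real {ω | localTime σ 1 ω ≤ x})) := by
  have hSm : ∀ N k : ℕ, Measurable fun ω => ((∑ i ∈ Finset.range k, l i ω : ℕ) : ℝ) / N :=
    fun N k => (measurable_from_nat.comp (hl.measurable_sum k)).div_const _
  have key := tendsto_measureReal_le_of_tendsto_mgf (l := atTop)
    (fun N : ℕ => hSm N ⌊x * b N⌋₊) (fun N => ae_of_all _ fun ω => by positivity)
    (hσ.measurable x) (hσ.ae_nonneg x) (fun n hn => by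
      have hn0 : (0 : ℝ) < n := by exact_mod_cast hn
      rw [hσ.mgf_eq hn0]
      exact hl.tendsto_mgf_sum hα₀ hα₁ hL hrec ha hb (NNReal.coe_pos.2 hx) hn0) hatom
  have hlimit : P.real {ω | localTime σ 1 ω ≤ x} = 1 - P.real {ω | σ x ω ≤ 1} := by
    rw [← probReal_compl_eq_one_sub (measurableSet_le (hσ.measurable x) measurable_const)]
    refine measureReal_congr ?_
    have hne : ∀ᵐ ω ∂P, σ x ω ≠ 1 := by
      rw [ae_iff]
      simpa using hatom
    filter_upwards [hσ.ae_localTime_le_iff 1, hne] with ω hω hne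
    refine propext ?_
    change localTime σ 1 ω ≤ x ↔ ¬ σ x ω ≤ 1
    rw [hω x, not_le]
    exact ⟨fun h => lt_of_le_of_ne h hne.symm, le_of_lt⟩
  rw [hlimit]
  refine (key.const_sub 1).congr' ?_
  filter_upwards [eventually_ge_atTop 1, hb.tendsto_atTop.eventually_gt_atTop 0] with N hN hbN
  have hN0 : (0 : ℝ) < N := by exact_mod_cast hN
  rw [← probReal_compl_eq_one_sub (measurableSet_le (hSm N _) measurable_const)]
  refine measureReal_congr ?_
  filter_upwards [hl.ae_pos hrec] with ω hω
  refine propext ?_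
  change ¬ ((∑ i ∈ Finset.range ⌊x * b N⌋₊, l i ω : ℕ) : ℝ) / N ≤ 1 ↔
    (renewalCount l N ω : ℝ) / b N ≤ x
  -- The count is an integer, so being at most `x * b N` is the same as being at most its floor.
  rw [not_le, one_lt_div hN0, Nat.cast_lt, ← renewalCount_le_iff hω, div_le_iff₀ hbN,
    Nat.le_floor_iff (by positivity)]

end Limit

theorem lemma1 {α : ℝ} (hα₀ : 0 < α) (hα₁ : α < 1)
    {L : ℝ → ℝ} (hL : IsSlowlyVarying L)
    -- recurrence: the weights `K n`, `n ≥ 1`, have total mass one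
    (hrec : HasSum (fun n : ℕ => interarrivalWeight α L (n + 1)) 1)
    {Ω : Type*} [MeasurableSpace Ω] (μ : Measure Ω) [IsProbabilityMeasure μ]
    {l : ℕ → Ω → ℕ} (hl : IsInterarrivalSequence (interarrivalWeight α L) l μ)
    {a b : ℕ → ℝ} (ha : IsStableNormalizing α L a) (hb : IsAsymptoticInverse a b)
    {Ω' : Type*} [MeasurableSpace Ω'] (P : Measure Ω') [IsProbabilityMeasure P]
    {σ : ℝ≥0 → Ω' → ℝ} (hσ : IsStableSubordinator α σ P) :
    TendstoInDistribution (fun (N : ℕ) ω => (renewalCount l N ω : ℝ) / b N) atTop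
      (localTime σ 1) (fun _ => μ) P := by
  have hcm : ∀ N : ℕ, AEMeasurable (fun ω => (renewalCount l N ω : ℝ) / b N) μ := fun N =>
    ((measurable_from_nat (f := fun n : ℕ => (n : ℝ))).comp_aemeasurable
      (hl.aemeasurable_renewalCount hrec N)).div_const _
  refine ⟨hcm, hσ.aemeasurable_localTime 1, ?_⟩
  -- Excluded points: the times at which 1 is an atom of `σ t`, and 0, where the floor index `⌊x * b
  -- N⌋` would not tend to infinity.
  set B : Set ℝ := (fun t : ℝ≥0 => (t : ℝ)) '' {t : ℝ≥0 | 0 < P {ω | σ t ω = 1}} ∪ {0}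
  have hB : B.Countable := ((hσ.countable_setOf_measure_pos hα₀ 1).image _).union
    (countable_singleton 0)
  refine tendsto_probabilityMeasure_of_tendsto_Iic (D := Bᶜ) (hB.dense_compl ℝ) fun x hx => ?_
  simp only [ProbabilityMeasure.coe_mk]
  have e1 : ∀ N : ℕ, (μ.map fun ω => (renewalCount l N ω : ℝ) / b N).real (Iic x) =
      μ.real {ω | (renewalCount l N ω : ℝ) / b N ≤ x} := fun N => by
    simp only [Measure.real]
    rw [Measure.map_apply_of_aemeasurable (hcm N) measurableSet_Iic]
    rfl
  have e2 : (P.map (localTime σ 1)).real (Iic x) = P.real {ω | localTime σ 1 ω ≤ x} := by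
    simp only [Measure.real]
    rw [Measure.map_apply_of_aemeasurable (hσ.aemeasurable_localTime 1) measurableSet_Iic]
    rfl
  simp only [e1, e2]
  simp only [B, mem_compl_iff, mem_union, mem_image, mem_singleton_iff, not_or, not_exists,
    not_and] at hx
  rcases lt_or_gt_of_ne hx.2 with hneg | hpos
  · have h1 : {ω | localTime σ 1 ω ≤ x} = ∅ := by
      ext ω
      simpa using hneg.trans_le (localTime_nonneg σ 1 ω)
    rw [h1, measureReal_empty]
    refine tendsto_const_nhds.congr' ?_
    filter_upwards [hb.tendsto_atTop.eventually_gt_atTop 0] with N hN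
    have h2 : {ω | (renewalCount l N ω : ℝ) / b N ≤ x} = ∅ := by
      ext ω
      simpa using hneg.trans_le (div_nonneg (Nat.cast_nonneg _) hN.le)
    rw [h2, measureReal_empty]
  · lift x to ℝ≥0 using hpos.le
    refine hl.tendsto_measureReal_renewalCount_div_le hα₀ hα₁ hL hrec ha hb hσ
      (NNReal.coe_pos.1 hpos) ?_
    by_contra hne
    exact hx.1 x (pos_iff_ne_zero.2 hne) rfl
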